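/- A probabilistic Büchi automaton (PBA) is a tuple $\mathcal A=(Q,\Sigma,\delta,\mu_0,F)$ with a finite state set $Q$, a finite alphabet $\Sigma$, a probability distribution $\delta(p,a,\cdot)$ on $Q$ for all $p\in Q$ and $a\in\Sigma$, an initial probability distribution $\mu_0$ on $Q$, and a set $F\subseteq Q$ of final states. A run of $\mathcal A$ on an infinite word $w=w_0w_1\ldots\in\Sigma^\omega$ is a sequence $q_0q_1\ldots\in Q^\omega$ with $\mu_0(q_0)>0$ and $\delta(q_i,w_i,q_{i+1})>0$ for all $i\ge 0$; it is accepting if $q_i\in F$ for infinitely many $i$. On each word $w$, the automaton induces the probability measure $\Pr_w$ on $Q^\omega$ for which the sequences with prefix $q_0\ldots q_n$ have probability $\mu_0(q_0)\prod_{i<n}\delta(q_i,w_i,q_{i+1})$. The automaton is finitely ambiguous if there is $k\in\mathbb N$ such that every $w\in\Sigma^\omega$ has at most $k$ accepting runs. For $\lambda\in(0,1)$, let $$L^{>\lambda}(\mathcal A)=\{w\in\Sigma^\omega \mid \Pr\nolimits_w(\text{accepting runs of }\mathcal A\text{ on }w)>\lambda\}.$$ **Theorem.** For every finitely ambiguous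 PBA $\mathcal A$ and every real threshold $\lambda\in(0,1)$, the language $L^{>\lambda}(\mathcal A)$ is $\omega$-regular, i.e. it is recognized by a nondeterministic Büchi automaton with finitely many states. -/

import Mathlib

open Filter MeasureTheory ProbabilityTheory

/-! ### Büchi automata

A nondeterministic Büchi automaton over the alphabet `α` with state set `σ` consists of a transition
relation, a set of initial states and a set of final states, which is exactly the data of Mathlib's
`NFA α σ`; only the acceptance condition (on infinite words) differs. An infinite word is a function
`w : ℕ → α`. -/

/-- `ρ` is a run of `M` on the infinite word `w`. -/
def NFA.IsInfiniteRun {α σ : Type*} (M : NFA α σ) (w : ℕ → α) (ρ : ℕ → σ) : Prop :=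
  ρ 0 ∈ M.start ∧ ∀ i, ρ (i + 1) ∈ M.step (ρ i) (w i)

/-- The set of runs of `M` on `w` that visit final states infinitely often. -/
def NFA.buchiRuns {α σ : Type*} (M : NFA α σ) (w : ℕ → α) : Set (ℕ → σ) :=
  {ρ | M.IsInfiniteRun w ρ ∧ ∃ᶠ i in atTop, ρ i ∈ M.accept}

/-- The language of infinite words recognized by `M` with the Büchi acceptance condition. -/
def NFA.buchiLanguage {α σ : Type*} (M : NFA α σ) : Set (ℕ → α) :=
  {w | (M.buchiRuns w).Nonempty}

/-- A language of infinite words is ω-regular if it is recognized by a nondeterministic Büchi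
automaton with finitely many states. -/
def IsOmegaRegular {α : Type*} (L : Set (ℕ → α)) : Prop :=
  ∃ (σ : Type) (_ : Finite σ) (M : NFA α σ), M.buchiLanguage = L

/-- The Büchi automaton `M` is `k`-ambiguous: every infinite word has at most `k` accepting runs. -/
def NFA.IsBuchiAmbiguous {α σ : Type*} (M : NFA α σ) (k : ℕ) : Prop :=
  ∀ w : ℕ → α, (M.buchiRuns w).encard ≤ k

/-! ### Probabilistic Büchi automata -/

/-- A probabilistic Büchi automaton with alphabet `α` and state set `Q`: an initial distribution, a
distribution on successor states for every state and symbol, and a set of final states. -/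
structure PBA (α Q : Type*) where
  /-- the initial distribution `μ₀` -/
  init : PMF Q
  /-- `step p a q` is the probability `δ(p, a, q)` -/
  step : Q → α → PMF Q
  /-- the set of final states `F` -/
  accept : Set Q

namespace PBA

/-- The underlying nondeterministic automaton: its transitions and initial states are those of
positive probability. -/
def underlying {α Q : Type*} (A : PBA α Q) : NFA α Q where
  step p a := (A.step p a).support
  start := A.init.support
  accept := A.accept

/-- A PBA is finitely ambiguous if, for some `k`, its underlying Büchi automaton has at most `k`
accepting runs on every infinite word. (Removing states from which no accepting run can continue
does not change the set of accepting runs, so the automaton need not be trimmed first.) -/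
def IsFinitelyAmbiguous {α Q : Type*} (A : PBA α Q) : Prop :=
  ∃ k : ℕ, A.underlying.IsBuchiAmbiguous k

section Measure

variable {α Q : Type*} [Countable Q] [MeasurableSpace Q] [DiscreteMeasurableSpace Q]

/-- The transition kernel of `A` at time `n` on the word `w`: given the states visited up to time
`n`, the next state is distributed according to `δ(qₙ, w(n), ·)`. -/
noncomputable def stepKernel (A : PBA α Q) (w : ℕ → α) (n : ℕ) :
    Kernel (Finset.Iic n → Q) Q :=
  Kernel.ofFunOfCountable fun x => (A.step (x ⟨n, Finset.mem_Iic.2 le_rfl⟩) (w n)).toMeasure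

instance (A : PBA α Q) (w : ℕ → α) (n : ℕ) : IsMarkovKernel (A.stepKernel w n) :=
  ⟨fun _ => PMF.toMeasure.isProbabilityMeasure _⟩

/-- The probability measure on infinite state sequences induced by `A` on the word `w` (the law of
the inhomogeneous Markov chain with initial distribution `μ₀` whose `n`-th step is given by
`δ(·, w(n), ·)`). -/
noncomputable def runMeasure (A : PBA α Q) (w : ℕ → α) : Measure (ℕ → Q) :=
  Kernel.trajMeasure (X := fun _ => Q) A.init.toMeasure (A.stepKernel w)

/-- The threshold language: the infinite words on which the set of accepting runs has probability
greater than `lam`. -/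
def thresholdLanguage (A : PBA α Q) (lam : ℝ) : Set (ℕ → α) :=
  {w | lam < (A.runMeasure w).real (A.underlying.buchiRuns w)}

end Measure

end PBA

/-! A finitely ambiguous automaton has finitely many accepting runs on `w`, so the acceptance
probability is the sum of the masses of these single runs. A run of positive mass eventually takes
only transitions of probability 1 (`eventually_step_eq_one`): the prefix products converge to a
nonzero limit, and only finitely many transition values exist. Its mass is therefore a finite
product, determined by how often each transition occurs in a prefix.

A Büchi automaton can thus guess a tuple of at most `k` runs and the time from which all are
deterministic. Unbounded counting is avoided because probabilities are at most 1: exceeding `lam` is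
a downward closed condition on the count vectors, so by Dickson's lemma counts capped at some `N`
decide it (`exists_cap_of_antitone`). Distinctness of the runs is visible in which tuple transitions
are used at all. -/

namespace PBA

/-! ### Masses of cylinders and single runs -/

section RunMeasure

variable {α Q : Type*} [Countable Q] [MeasurableSpace Q] [DiscreteMeasurableSpace Q]

instance (A : PBA α Q) (w : ℕ → α) : IsProbabilityMeasure (A.runMeasure w) := by
  unfold runMeasure
  infer_instance

theorem runMeasure_map_frestrictLe_zero (A : PBA α Q) (w : ℕ → α) :
    (A.runMeasure w).map (Preorder.frestrictLe (π := fun _ => Q) 0) =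
      A.init.toMeasure.map (MeasurableEquiv.piUnique (fun _ : Finset.Iic 0 => Q)).symm := by
  rw [runMeasure, Kernel.trajMeasure, Measure.map_comp _ _ (by fun_prop),
    Kernel.traj_map_frestrictLe, Kernel.partialTraj_self, Measure.id_comp]

theorem runMeasure_cylinder (A : PBA α Q) (w : ℕ → α) (ρ : ℕ → Q) (n : ℕ) :
    A.runMeasure w {x | ∀ i ≤ n, x i = ρ i} =
      A.init (ρ 0) * ∏ i ∈ Finset.range n, A.step (ρ i) (w i) (ρ (i + 1)) := by
  have key (m : ℕ) : {x : ℕ → Q | ∀ i ≤ m, x i = ρ i} =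
      Preorder.frestrictLe (π := fun _ => Q) m ⁻¹' {Preorder.frestrictLe m ρ} := by
    ext x
    simp [funext_iff]
  induction n with
  | zero =>
    rw [key, ← Measure.map_apply (by fun_prop) (measurableSet_singleton _),
      runMeasure_map_frestrictLe_zero, Measure.map_apply (by fun_prop) (measurableSet_singleton _)]
    have : (MeasurableEquiv.piUnique (fun _ : Finset.Iic 0 => Q)).symm ⁻¹'
        {Preorder.frestrictLe (π := fun _ => Q) 0 ρ} = {ρ 0} := by
      ext q
      simp [funext_iff]
    rw [this, PMF.toMeasure_apply_singleton _ _ (measurableSet_singleton _)]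
    simp
  | succ n ih =>
    have hset : {x : ℕ → Q | ∀ i ≤ n + 1, x i = ρ i} =
        (fun x : ℕ → Q => (Preorder.frestrictLe (π := fun _ => Q) n x, x (n + 1))) ⁻¹'
          ({Preorder.frestrictLe n ρ} ×ˢ {ρ (n + 1)}) := by
      ext x
      simp only [Set.mem_ofPred_eq, Set.mem_preimage, Set.mem_prod, Set.mem_singleton_iff,
        Nat.le_succ_iff, or_imp, forall_and, forall_eq]
      simp [funext_iff]
    have hm := (Kernel.map_frestrictLe_trajMeasure_compProd_eq_map_trajMeasure (X := fun _ => Q)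
      (μ₀ := A.init.toMeasure) (κ := A.stepKernel w) (a := n))
    rw [hset, ← Measure.map_apply (by fun_prop)
      ((measurableSet_singleton _).prod (measurableSet_singleton _)), runMeasure, ← hm,
      Measure.compProd_apply_prod (measurableSet_singleton _) (measurableSet_singleton _),
      lintegral_singleton, Measure.map_apply (by fun_prop) (measurableSet_singleton _), ← key]
    change _ * A.runMeasure w _ = _
    rw [ih, Finset.prod_range_succ]
    simp only [stepKernel, Kernel.ofFunOfCountable, Kernel.coe_mk]
    rw [PMF.toMeasure_apply_singleton _ _ (measurableSet_singleton _)]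
    simp only [Preorder.frestrictLe_apply]
    ring

/-- A point is the decreasing intersection of its cylinders; apply continuity from above. -/
theorem tendsto_prefix_runMeasure_singleton (A : PBA α Q) (w : ℕ → α) (ρ : ℕ → Q) :
    Tendsto (fun n => A.init (ρ 0) * ∏ i ∈ Finset.range n, A.step (ρ i) (w i) (ρ (i + 1))) atTop
      (nhds (A.runMeasure w {ρ})) := by
  have hinter : {ρ} = ⋂ n, {x : ℕ → Q | ∀ i ≤ n, x i = ρ i} := by
    ext x
    simp only [Set.mem_singleton_iff, Set.mem_iInter, Set.mem_ofPred_eq, funext_iff]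
    exact ⟨fun h n i _ => h i, fun h i => h i i le_rfl⟩
  simp_rw [← runMeasure_cylinder]
  rw [hinter]
  refine tendsto_measure_iInter_atTop (fun n => ?_) (fun m n hmn x hx i hi => hx i (hi.trans hmn))
    ⟨0, measure_ne_top _ _⟩
  refine MeasurableSet.nullMeasurableSet ?_
  measurability

theorem runMeasure_singleton_eq_prefix (A : PBA α Q) (w : ℕ → α) (ρ : ℕ → Q) (m : ℕ)
    (h : ∀ n ≥ m, A.step (ρ n) (w n) (ρ (n + 1)) = 1) :
    A.runMeasure w {ρ} =
      A.init (ρ 0) * ∏ i ∈ Finset.range m, A.step (ρ i) (w i) (ρ (i + 1)) := by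
  refine tendsto_nhds_unique (tendsto_prefix_runMeasure_singleton A w ρ)
    (tendsto_atTop_of_eventually_const (i₀ := m) fun n hn => ?_)
  rw [← Finset.prod_range_mul_prod_Ico _ hn,
    Finset.prod_eq_one (s := Finset.Ico m n) fun i hi => h i (Finset.mem_Ico.1 hi).1, mul_one]

theorem eventually_step_eq_one [Finite α] [Finite Q] (A : PBA α Q) (w : ℕ → α) (ρ : ℕ → Q)
    (h : A.runMeasure w {ρ} ≠ 0) :
    ∀ᶠ n in atTop, A.step (ρ n) (w n) (ρ (n + 1)) = 1 := by
  have hlim := tendsto_prefix_runMeasure_singleton A w ρ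
  set u : ℕ → ENNReal :=
    fun n => A.init (ρ 0) * ∏ i ∈ Finset.range n, A.step (ρ i) (w i) (ρ (i + 1)) with hu
  set v := A.runMeasure w {ρ}
  have hv : v ≠ ⊤ := measure_ne_top _ _
  have hu0 : ∀ᶠ n in atTop, u n ≠ 0 ∧ u n ≠ ⊤ := (hlim.eventually_ne h).and (hlim.eventually_ne hv)
  -- Successive ratios are the transition probabilities, and they tend to 1 because the limit is
  -- nonzero and finite.
  have hdiv : Tendsto (fun n => u (n + 1) / u n) atTop (nhds (v / v)) :=
    ENNReal.Tendsto.div ((tendsto_add_atTop_iff_nat 1).2 hlim) (Or.inl h) hlim (Or.inl hv)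
  rw [ENNReal.div_self h hv] at hdiv
  have hstep : Tendsto (fun n => A.step (ρ n) (w n) (ρ (n + 1))) atTop (nhds 1) := by
    refine hdiv.congr' (hu0.mono fun n hn => ?_)
    have : u (n + 1) = u n * A.step (ρ n) (w n) (ρ (n + 1)) := by
      simp only [hu, Finset.prod_range_succ, mul_assoc]
    rw [this, mul_comm, ENNReal.mul_div_cancel_right hn.1 hn.2]
  have hfin : (Set.range fun t : Q × α × Q => A.step t.1 t.2.1 t.2.2).Finite := Set.finite_range _
  -- The finitely many values other than 1 stay away from 1, so convergence to 1 means eventual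
  -- equality.
  have hclosed : IsClosed ((Set.range fun t : Q × α × Q => A.step t.1 t.2.1 t.2.2) \ {1}) :=
    (hfin.subset Set.sdiff_subset).isClosed
  have hev := hstep.eventually (hclosed.isOpen_compl.mem_nhds (by simp))
  refine hev.mono fun n hn => ?_
  by_contra hne
  exact hn ⟨⟨(ρ n, w n, ρ (n + 1)), rfl⟩, hne⟩

end RunMeasure

end PBA

/-! ### Closure properties of ω-regular languages -/

/-- Relabelling by `Fin n` moves the states into `Type`, as `IsOmegaRegular` demands. -/
theorem isOmegaRegular_buchiLanguage {α σ : Type*} [Finite σ] (M : NFA α σ) :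
    IsOmegaRegular M.buchiLanguage := by
  obtain ⟨n, ⟨e⟩⟩ := Finite.exists_equiv_fin σ
  let M' : NFA α (Fin n) :=
    { step := fun p a => {q | e.symm q ∈ M.step (e.symm p) a}
      start := {q | e.symm q ∈ M.start}
      accept := {q | e.symm q ∈ M.accept} }
  refine ⟨Fin n, inferInstance, M', Set.ext fun w => ⟨?_, ?_⟩⟩
  · rintro ⟨ρ, ⟨h0, hs⟩, hacc⟩
    exact ⟨fun i => e.symm (ρ i), ⟨h0, hs⟩, hacc⟩
  · rintro ⟨ρ, ⟨h0, hs⟩, hacc⟩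
    refine ⟨fun i => e (ρ i), ⟨?_, fun i => ?_⟩, ?_⟩
    · simpa [M'] using h0
    · simpa [M'] using hs i
    · simpa [M'] using hacc

theorem IsOmegaRegular.iUnion {α ι : Type*} [Finite ι] {L : ι → Set (ℕ → α)}
    (h : ∀ i, IsOmegaRegular (L i)) : IsOmegaRegular (⋃ i, L i) := by
  choose σ hσ M hM using h
  let M' : NFA α (Σ i, σ i) :=
    { step := fun p a => Sigma.mk p.1 '' (M p.1).step p.2 a
      start := {q | q.2 ∈ (M q.1).start}
      accept := {q | q.2 ∈ (M q.1).accept} }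
  suffices hM' : M'.buchiLanguage = ⋃ i, L i from hM' ▸ isOmegaRegular_buchiLanguage M'
  ext w
  simp only [Set.mem_iUnion, ← hM]
  constructor
  · rintro ⟨ρ, ⟨h0, hs⟩, hacc⟩
    have hconst : ∀ n, ∃ q, ρ n = ⟨(ρ 0).1, q⟩ := by
      intro n
      induction n with
      | zero => exact ⟨_, rfl⟩
      | succ n ih =>
        obtain ⟨q, hq⟩ := ih
        have hstep := hs n
        rw [hq] at hstep
        obtain ⟨q', -, hq'⟩ := hstep
        exact ⟨_, hq'.symm⟩
    choose r hr using hconst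
    refine ⟨(ρ 0).1, r, ⟨?_, fun n => ?_⟩, ?_⟩
    · have := h0
      rw [hr 0] at this
      exact this
    · have := hs n
      rw [hr n, hr (n + 1)] at this
      obtain ⟨q, hq, hq'⟩ := this
      cases hq'
      exact hq
    · refine hacc.mono fun n hn => ?_
      rw [hr n] at hn
      exact hn
  · rintro ⟨i, r, ⟨h0, hs⟩, hacc⟩
    exact ⟨fun n => ⟨i, r n⟩, ⟨h0, fun n => ⟨_, hs n, rfl⟩⟩, hacc⟩

/-- If `b` collects the indices `i` for which `p i` has held since the last time `b` was full, then
`b` is full infinitely often iff every `p i` holds infinitely often. -/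
theorem frequently_eq_univ_iff_of_breakpoint {ι : Type*} [Finite ι] {p : ι → ℕ → Prop}
    {b : ℕ → Set ι} (hb : ∀ n, b (n + 1) = {i | (i ∈ b n ∧ b n ≠ Set.univ) ∨ p i n}) :
    (∃ᶠ n in atTop, b n = Set.univ) ↔ ∀ i, ∃ᶠ n in atTop, p i n := by
  constructor
  · intro h i
    rw [frequently_atTop] at h ⊢
    intro m
    by_contra! hcon
    obtain ⟨n, hmn, hn⟩ := h m
    obtain ⟨n', hnn', hn'⟩ := h (n + 1)
    -- The reset after time `n` removes `i`, which can only return through `p i`.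
    have hnot : ∀ l ≥ n + 1, i ∉ b l := by
      intro l hl
      induction l, hl using Nat.le_induction with
      | base =>
        rw [hb]
        rintro (⟨-, h⟩ | h)
        · exact h hn
        · exact hcon n hmn h
      | succ l hl ih =>
        rw [hb]
        rintro (⟨h, -⟩ | h)
        · exact ih h
        · exact hcon l (by omega) h
    exact hnot n' hnn' (hn' ▸ Set.mem_univ i)
  · intro h hcon
    obtain ⟨m, hm⟩ := eventually_atTop.1 hcon
    have hev : ∀ i, ∀ᶠ n in atTop, i ∈ b n := by
      intro i
      obtain ⟨n, hmn, hn⟩ := frequently_atTop.1 (h i) m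
      refine eventually_atTop.2 ⟨n + 1, fun l hl => ?_⟩
      induction l, hl using Nat.le_induction with
      | base => rw [hb]; exact Or.inr hn
      | succ l hl ih => rw [hb]; exact Or.inl ⟨ih, hm l (by omega)⟩
    obtain ⟨n, hn, hn'⟩ := ((eventually_all.2 hev).and hcon).exists
    exact hn' (Set.eq_univ_of_forall hn)

/-- Generalized Büchi acceptance conditions define ω-regular languages. -/
theorem isOmegaRegular_generalizedBuchi {α σ ι : Type*} [Finite σ] [Finite ι] (M : NFA α σ)
    (F : ι → Set σ) :
    IsOmegaRegular {w : ℕ → α | ∃ ρ, M.IsInfiniteRun w ρ ∧ ∀ i, ∃ᶠ n in atTop, ρ n ∈ F i} := by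
  let upd : σ × Set ι → Set ι := fun p => {i | (i ∈ p.2 ∧ p.2 ≠ Set.univ) ∨ p.1 ∈ F i}
  let M' : NFA α (σ × Set ι) :=
    { step := fun p a => M.step p.1 a ×ˢ {upd p}
      start := M.start ×ˢ {∅}
      accept := {p | p.2 = Set.univ} }
  convert isOmegaRegular_buchiLanguage M' using 1
  ext w
  constructor
  · rintro ⟨ρ, ⟨h0, hs⟩, hF⟩
    let b : ℕ → Set ι := fun n => Nat.rec ∅ (fun n B => upd (ρ n, B)) n
    refine ⟨fun n => (ρ n, b n), ⟨⟨h0, rfl⟩, fun n => ⟨hs n, rfl⟩⟩, ?_⟩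
    exact (frequently_eq_univ_iff_of_breakpoint (p := fun i n => ρ n ∈ F i) (b := b)
      fun n => rfl).2 hF
  · rintro ⟨ρ, ⟨h0, hs⟩, hacc⟩
    refine ⟨fun n => (ρ n).1, ⟨h0.1, fun n => (hs n).1⟩, ?_⟩
    exact (frequently_eq_univ_iff_of_breakpoint (p := fun i n => (ρ n).1 ∈ F i)
      (b := fun n => (ρ n).2) fun n => (hs n).2).1 hacc

/-! ### Counting transitions up to a bound -/

/-- By Dickson's lemma, a downward closed set of vectors of natural numbers only depends on the
coordinates capped at some bound. -/
theorem exists_cap_of_antitone {S : Type*} [Finite S] {P : (S → ℕ) → Prop} (hP : Antitone P) :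
    ∃ N, ∀ N' ≥ N, ∀ n, P n ↔ P (fun s => min (n s) N') := by
  -- The minimal violations form an antichain, hence a finite set; `N` bounds all their coordinates,
  -- so capping at `N` keeps any vector above them.
  have hfin : {y | Minimal (fun n => ¬ P n) y}.Finite :=
    WellQuasiOrderedLE.finite_of_isAntichain (setOfPred_minimal_antichain _)
  obtain ⟨N, hN⟩ := (hfin.image fun y : S → ℕ => ⨆ s, y s).bddAbove
  refine ⟨N, fun N' hN' n => ⟨hP fun s => min_le_left _ _, fun h => ?_⟩⟩
  by_contra hn
  obtain ⟨y, hyn, hy⟩ := exists_minimal_le_of_wellFoundedLT (fun n => ¬ P n) n hn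
  refine hy.1 (hP (fun s => le_min (hyn s) ?_) h)
  exact ((le_ciSup (Set.finite_range y).bddAbove s).trans
    (hN (Set.mem_image_of_mem (fun y : S → ℕ => ⨆ s, y s) hy))).trans hN'

open Classical in
/-- How often each transition is used in the first `m` steps of the state sequence `ρ` on `w`. -/
noncomputable def transitionCount {α X : Type*} (w : ℕ → α) (ρ : ℕ → X) (m : ℕ) :
    X × α × X → ℕ :=
  fun s => Nat.count (fun n => (ρ n, w n, ρ (n + 1)) = s) m

/-- The state sequences satisfying a condition `P` on the number of uses of each transition in a
finite prefix, after which all transitions belong to `R`, and a generalized Büchi condition,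
define an ω-regular language, if `P` only depends on the numbers capped at `N`. -/
theorem isOmegaRegular_prefixCount {α X ι : Type*} [Finite α] [Finite X] [Finite ι]
    (M : NFA α X) (R : X → α → X → Prop) (F : ι → Set X) (P : (X × α × X → ℕ) → Prop) (N : ℕ)
    (hP : ∀ n, P n ↔ P (fun s => min (n s) N)) :
    IsOmegaRegular {w : ℕ → α | ∃ ρ, M.IsInfiniteRun w ρ ∧
      (∃ m, P (transitionCount w ρ m) ∧ ∀ n ≥ m, R (ρ n) (w n) (ρ (n + 1))) ∧
      ∀ i, ∃ᶠ n in atTop, ρ n ∈ F i} := by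
  classical
  let cap : (X × α × X → ℕ) → (X × α × X → Fin (N + 1)) :=
    fun n s => ⟨min (n s) N, by omega⟩
  have hcap : ∀ n, P (fun s => cap n s) ↔ P n := fun n => (hP n).symm
  let upd : (X × α × X → Fin (N + 1)) → X × α × X → (X × α × X → Fin (N + 1)) :=
    fun c t => cap fun s => c s + if t = s then 1 else 0
  -- `some c` is the counting phase with capped counts `c`; `none` is the absorbing phase in which
  -- `R` is enforced. The step into `none` checks `P` and already needs `R`.
  let M' : NFA α (X × Option (X × α × X → Fin (N + 1))) :=
    { step := fun p a => {q | q.1 ∈ M.step p.1 a ∧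
        ((∃ c, p.2 = some c ∧ q.2 = some (upd c (p.1, a, q.1))) ∨
          (q.2 = none ∧ R p.1 a q.1 ∧ ∀ c, p.2 = some c → P (fun s => c s)))}
      start := M.start ×ˢ {some (cap 0)}
      accept := ∅ }
  -- The extra condition at `none` forces the switch to happen.
  let F' : Option ι → Set (X × Option (X × α × X → Fin (N + 1))) :=
    fun o => o.elim {p | p.2 = none} fun i => {p | p.1 ∈ F i}
  have hupd (w : ℕ → α) (ρ : ℕ → X) (n : ℕ) :
      upd (cap (transitionCount w ρ n)) (ρ n, w n, ρ (n + 1)) =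
        cap (transitionCount w ρ (n + 1)) := by
    ext s
    simp only [upd, cap, transitionCount, Nat.count_succ]
    split_ifs <;> omega
  have hzero (w : ℕ → α) (ρ : ℕ → X) : transitionCount w ρ 0 = 0 := by
    ext s
    simp [transitionCount]
  convert isOmegaRegular_generalizedBuchi M' F' using 1
  ext w
  constructor
  · rintro ⟨ρ, ⟨h0, hs⟩, ⟨m, hPm, hR⟩, hF⟩
    refine ⟨fun n => (ρ n, if n ≤ m then some (cap (transitionCount w ρ n)) else none),
      ⟨⟨h0, by simp [hzero]⟩, fun n => ⟨hs n, ?_⟩⟩, ?_⟩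
    · rcases lt_or_ge n m with hn | hn
      · refine Or.inl ⟨_, if_pos hn.le, ?_⟩
        rw [hupd]
        exact if_pos hn
      · refine Or.inr ⟨if_neg (by omega), hR n hn, fun c hc => ?_⟩
        dsimp only at hc
        split_ifs at hc with hnm
        obtain rfl : n = m := le_antisymm hnm hn
        cases hc
        exact (hcap _).2 hPm
    · rintro (_ | i)
      · refine (eventually_atTop.2 ⟨m + 1, fun n hn => ?_⟩).frequently
        exact if_neg (by omega)
      · exact hF i
  · rintro ⟨r, ⟨h0, hs⟩, hF⟩
    have hex : ∃ n, (r n).2 = none := (hF none).exists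
    have hr0 : (r 0).2 = some (cap 0) := h0.2
    -- `m` is the last counting position, so its state carries the counts of the first `m` steps.
    obtain ⟨m, hm⟩ : ∃ m, Nat.find hex = m + 1 := by
      refine Nat.exists_eq_succ_of_ne_zero fun h => ?_
      have := Nat.find_spec hex
      rw [h, hr0] at this
      simp at this
    have hnone : ∀ n ≥ m, (r (n + 1)).2 = none := by
      intro n hn
      induction n, hn using Nat.le_induction with
      | base => rw [← hm]; exact Nat.find_spec hex
      | succ n hn ih =>
        obtain ⟨-, ⟨c, hc, -⟩ | ⟨h, -⟩⟩ := hs (n + 1)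
        · rw [ih] at hc
          simp at hc
        · exact h
    have hsome : ∀ n ≤ m, (r n).2 = some (cap (transitionCount w (fun n => (r n).1) n)) := by
      intro n hn
      induction n with
      | zero => rw [hr0, hzero]
      | succ n ih =>
        obtain ⟨-, ⟨c, hc, hc'⟩ | ⟨h, -⟩⟩ := hs n
        · rw [ih (by omega)] at hc
          cases hc
          rw [hc', ← hupd]
        · exact absurd h (Nat.find_min hex (by omega))
    have hlate : ∀ n ≥ m, R (r n).1 (w n) (r (n + 1)).1 ∧
        ∀ c, (r n).2 = some c → P (fun s => c s) := by
      intro n hn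
      obtain ⟨-, ⟨c, -, hc⟩ | ⟨-, h⟩⟩ := hs n
      · rw [hnone n hn] at hc
        simp at hc
      · exact h
    exact ⟨fun n => (r n).1, ⟨h0.1, fun n => (hs n).1⟩,
      ⟨m, (hcap _).1 ((hlate m le_rfl).2 _ (hsome m le_rfl)), fun n hn => (hlate n hn).1⟩,
      fun i => hF (some i)⟩

/-! ### Threshold languages as existence of tuples of runs -/

theorem prod_pow_transitionCount {α X : Type*} [Fintype α] [Fintype X] (w : ℕ → α) (ρ : ℕ → X)
    (m : ℕ) (v : X × α × X → ℝ) :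
    ∏ s, v s ^ transitionCount w ρ m s = ∏ n ∈ Finset.range m, v (ρ n, w n, ρ (n + 1)) := by
  classical
  induction m with
  | zero => simp [transitionCount]
  | succ m ih =>
    rw [Finset.prod_range_succ, ← ih]
    simp only [transitionCount, Nat.count_succ, pow_add, Finset.prod_mul_distrib]
    congr 1
    rw [Finset.prod_eq_single (ρ m, w m, ρ (m + 1))] <;> simp +contextual [eq_comm]

theorem transitionCount_pos {α X : Type*} {w : ℕ → α} {ρ : ℕ → X} {m : ℕ} {s : X × α × X} :
    0 < transitionCount w ρ m s ↔ ∃ n < m, (ρ n, w n, ρ (n + 1)) = s := by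
  simp [transitionCount, Nat.count_eq_card_filter_range, Finset.card_pos, Finset.Nonempty]

namespace PBA

variable {α Q : Type*}

/-- The automaton whose runs are the tuples of runs of `A` starting in the states `q`. -/
def tuple (A : PBA α Q) {ι : Type*} (q : ι → Q) : NFA α (ι → Q) where
  step x a := {y | ∀ i, y i ∈ (A.step (x i) a).support}
  start := {q}
  accept := ∅

/-- The transition numbers `n` witness that the components of a tuple of runs starting in the states
`q` are distinct, and that the product of the probabilities along the components sum up to more
than `lam`. -/
def TupleCondition [Fintype α] [Fintype Q] (A : PBA α Q) {ι : Type*} [Fintype ι] (lam : ℝ)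
    (q : ι → Q) (n : (ι → Q) × α × (ι → Q) → ℕ) : Prop :=
  (∀ i j, i ≠ j → ∃ s, 0 < n s ∧ s.1 i ≠ s.1 j) ∧
    lam < ∑ i, (A.init (q i)).toReal *
      ∏' s : (ι → Q) × α × (ι → Q), (A.step (s.1 i) s.2.1 (s.2.2 i)).toReal ^ n s

theorem exists_cap_tupleCondition [Fintype α] [Fintype Q] (A : PBA α Q) {ι : Type*} [Fintype ι]
    (lam : ℝ) (q : ι → Q) :
    ∃ N, ∀ n, A.TupleCondition lam q n ↔ A.TupleCondition lam q fun s => min (n s) N := by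
  classical
  obtain ⟨N, hN⟩ := exists_cap_of_antitone (S := (ι → Q) × α × (ι → Q))
    (P := fun n => lam < ∑ i, (A.init (q i)).toReal *
      ∏' s : (ι → Q) × α × (ι → Q), (A.step (s.1 i) s.2.1 (s.2.2 i)).toReal ^ n s) <| by
    intro n n' hn h
    refine h.trans_le (Finset.sum_le_sum fun i _ => ?_)
    simp only [tprod_fintype]
    refine mul_le_mul_of_nonneg_left (Finset.prod_le_prod (fun s _ => by positivity) fun s _ =>
      pow_le_pow_of_le_one ENNReal.toReal_nonneg ?_ (hn s)) ENNReal.toReal_nonneg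
    exact ENNReal.toReal_mono ENNReal.one_ne_top (PMF.coe_le_one _ _)
  -- Distinctness depends only on which counts are positive, which a cap of at least 1 preserves.
  refine ⟨N + 1, fun n => and_congr ?_ (hN (N + 1) (by omega) n)⟩
  simp

/-- The words on which some tuple of distinct accepting runs starting in `q` has total probability
greater than `lam`, expressed by the transitions used before all transitions become
deterministic. -/
def tupleLanguage [Fintype α] [Fintype Q] (A : PBA α Q) {ι : Type*} [Fintype ι] (lam : ℝ)
    (q : ι → Q) : Set (ℕ → α) :=
  {w | ∃ ρ, (A.tuple q).IsInfiniteRun w ρ ∧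
    (∃ m, A.TupleCondition lam q (transitionCount w ρ m) ∧
      ∀ n ≥ m, ∀ i, A.step (ρ n i) (w n) (ρ (n + 1) i) = 1) ∧
    ∀ i, ∃ᶠ n in atTop, ρ n i ∈ A.accept}

theorem isOmegaRegular_tupleLanguage [Fintype α] [Fintype Q] (A : PBA α Q) {ι : Type*} [Fintype ι]
    (lam : ℝ) (q : ι → Q) : IsOmegaRegular (A.tupleLanguage lam q) := by
  obtain ⟨N, hN⟩ := A.exists_cap_tupleCondition lam q
  exact isOmegaRegular_prefixCount (A.tuple q) (fun x a y => ∀ i, A.step (x i) a (y i) = 1)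
    (fun i => {x | x i ∈ A.accept}) _ N hN

theorem real_runMeasure_singleton [Countable Q] [MeasurableSpace Q] [DiscreteMeasurableSpace Q]
    (A : PBA α Q) (w : ℕ → α) (ρ : ℕ → Q) (m : ℕ)
    (h : ∀ n ≥ m, A.step (ρ n) (w n) (ρ (n + 1)) = 1) :
    (A.runMeasure w).real {ρ} = (A.init (ρ 0)).toReal *
      ∏ i ∈ Finset.range m, (A.step (ρ i) (w i) (ρ (i + 1))).toReal := by
  rw [Measure.real, A.runMeasure_singleton_eq_prefix w ρ m h, ENNReal.toReal_mul,
    ENNReal.toReal_prod]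

variable [Fintype α] [Fintype Q] [MeasurableSpace Q] [DiscreteMeasurableSpace Q]

theorem sum_prod_pow_transitionCount (A : PBA α Q) {ι : Type*} [Fintype ι]
    {q : ι → Q} {w : ℕ → α} {ρ : ℕ → ι → Q} (h0 : ρ 0 = q) {m : ℕ}
    (h : ∀ n ≥ m, ∀ i, A.step (ρ n i) (w n) (ρ (n + 1) i) = 1) :
    ∑ i, (A.init (q i)).toReal * ∏' s : (ι → Q) × α × (ι → Q),
      (A.step (s.1 i) s.2.1 (s.2.2 i)).toReal ^ transitionCount w ρ m s =
      ∑ i, (A.runMeasure w).real {fun n => ρ n i} := by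
  classical
  refine Finset.sum_congr rfl fun i _ => ?_
  rw [A.real_runMeasure_singleton w _ m fun n hn => h n hn i, tprod_fintype,
    prod_pow_transitionCount w ρ m fun s => (A.step (s.1 i) s.2.1 (s.2.2 i)).toReal, h0]

/-- Distinct runs are disjoint singletons inside the accepting event, so their masses add up to a
lower bound. -/
theorem tupleLanguage_subset_thresholdLanguage (A : PBA α Q) {ι : Type*} [Fintype ι] (lam : ℝ)
    {q : ι → Q} (hq : ∀ i, q i ∈ A.init.support) :
    A.tupleLanguage lam q ⊆ A.thresholdLanguage lam := by
  classical
  rintro w ⟨ρ, ⟨h0, hs⟩, ⟨m, ⟨hne, hlam⟩, hone⟩, hacc⟩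
  rw [A.sum_prod_pow_transitionCount h0 hone] at hlam
  have hinj : Function.Injective fun i n => ρ n i := by
    intro i j hij
    by_contra hne'
    obtain ⟨s, hs, hs'⟩ := hne i j hne'
    obtain ⟨n, -, rfl⟩ := transitionCount_pos.1 hs
    exact hs' (congrFun hij n)
  refine hlam.trans_le ?_
  rw [← Finset.sum_image (s := Finset.univ) (f := fun x => (A.runMeasure w).real {x})
    hinj.injOn, sum_measureReal_singleton]
  refine measureReal_mono ?_
  rintro _ hx
  obtain ⟨i, -, rfl⟩ := Finset.mem_image.1 (Finset.mem_coe.1 hx)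
  refine ⟨⟨?_, fun n => hs n i⟩, hacc i⟩
  change ρ 0 i ∈ A.init.support
  rw [h0]
  exact hq i

theorem exists_mem_tupleLanguage (A : PBA α Q) {k : ℕ} (hk : A.underlying.IsBuchiAmbiguous k)
    {lam : ℝ} {w : ℕ → α} (hw : w ∈ A.thresholdLanguage lam) :
    ∃ j ≤ k, ∃ q : Fin j → Q, (∀ i, q i ∈ A.init.support) ∧ w ∈ A.tupleLanguage lam q := by
  classical
  have hfin : (A.underlying.buchiRuns w).Finite :=
    Set.finite_of_encard_le_coe (hk w)
  set T := hfin.toFinset with hT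
  have hcard : T.card ≤ k := by
    have := hk w
    rwa [hfin.encard_eq_coe_toFinset_card, Nat.cast_le] at this
  -- Null runs add nothing to the sum and need not become deterministic, so they are dropped.
  set U := T.filter fun x => (A.runMeasure w).real {x} ≠ 0 with hU
  let e := U.equivFin.symm
  have hmem (i : Fin U.card) : (e i).1 ∈ A.underlying.buchiRuns w ∧
      A.runMeasure w {(e i).1} ≠ 0 := by
    have := (e i).2
    simp only [hU, Finset.mem_filter, hT, Set.Finite.mem_toFinset] at this
    exact ⟨this.1, fun h => this.2 (by simp [Measure.real, h])⟩
  refine ⟨U.card, (Finset.card_filter_le _ _).trans hcard, fun i => (e i).1 0,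
    fun i => (hmem i).1.1.1, fun n i => (e i).1 n, ⟨rfl, fun n i => (hmem i).1.1.2 n⟩, ?_,
    fun i => (hmem i).1.2⟩
  have hone : ∀ᶠ m in atTop, ∀ n ≥ m, ∀ i, A.step ((e i).1 n) (w n) ((e i).1 (n + 1)) = 1 :=
    eventually_forall_ge_atTop.2 <| eventually_all.2 fun i =>
      A.eventually_step_eq_one w _ (hmem i).2
  have hne : ∀ᶠ m in atTop, ∀ i j, i ≠ j → ∃ n < m, (e i).1 n ≠ (e j).1 n := by
    refine eventually_all.2 fun i => eventually_all.2 fun j => ?_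
    by_cases hij : i = j
    · simp [hij]
    obtain ⟨n, hn⟩ := Function.ne_iff.1 fun h => hij (e.injective (Subtype.ext h))
    exact (eventually_gt_atTop n).mono fun m hm _ => ⟨n, hm, hn⟩
  -- The prefix must be long enough both to reach determinism and to separate every pair of runs.
  obtain ⟨m, hm, hm'⟩ := (hone.and hne).exists
  refine ⟨m, ⟨fun i j hij => ?_, ?_⟩, hm⟩
  · obtain ⟨n, hn, hn'⟩ := hm' i j hij
    exact ⟨_, transitionCount_pos.2 ⟨n, hn, rfl⟩, hn'⟩
  · rw [A.sum_prod_pow_transitionCount (ρ := fun n i => (e i).1 n) rfl hm]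
    refine lt_of_lt_of_eq hw ?_
    rw [← hfin.coe_toFinset, ← sum_measureReal_singleton, ← hT,
      ← Finset.sum_filter_ne_zero T, ← hU, ← Finset.sum_coe_sort,
      ← Equiv.sum_comp e fun x : U => (A.runMeasure w).real {x.1}]

end PBA

theorem mainTheorem3 {α Q : Type*} [Finite α] [Finite Q]
    [MeasurableSpace Q] [DiscreteMeasurableSpace Q]
    (A : PBA α Q) (hA : A.IsFinitelyAmbiguous)
    (lam : ℝ) (hlam0 : 0 < lam) (hlam1 : lam < 1) :
    IsOmegaRegular (A.thresholdLanguage lam) := by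
  classical
  have := Fintype.ofFinite α
  have := Fintype.ofFinite Q
  obtain ⟨k, hk⟩ := hA
  have hunion : A.thresholdLanguage lam =
      ⋃ c : Σ j : Fin (k + 1), {q : Fin j → Q // ∀ i, q i ∈ A.init.support},
        A.tupleLanguage lam c.2.1 := by
    refine Set.Subset.antisymm (fun w hw => ?_)
      (Set.iUnion_subset fun c => A.tupleLanguage_subset_thresholdLanguage lam c.2.2)
    obtain ⟨j, hj, q, hq, hw⟩ := A.exists_mem_tupleLanguage hk hw
    exact Set.mem_iUnion.2 ⟨⟨⟨j, by omega⟩, q, hq⟩, hw⟩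
  rw [hunion]
  exact .iUnion fun c => A.isOmegaRegular_tupleLanguage lam c.2.1
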